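/- Let $k$ be an algebraically closed field of characteristic zero, and let $\mathcal C$ be a braided tensor category over $k$, that is, a $k$-linear abelian braided monoidal category whose tensor product is $k$-bilinear on morphisms and whose unit object $I$ is simple. Let $A$ be an étale algebra in $\mathcal C$: an associative unital algebra with multiplication $m\colon A\otimes A\to A$ which is commutative ($m\circ c_{A,A}=m$ for the braiding $c$), separable ($m$ has a section $A\to A\otimes A$ which is a morphism of $A$-bimodules) and connected ($\dim_k\mathcal C(I,A)=1$). Let $H$ be a Hopf algebra over $k$ acting on $A$, that is, given together with a homomorphism of unital $k$-algebras $a\colon H\to\mathcal C(A,A)$ (with composition as the product of $\mathcal C(A,A)$) such that $a(h)\circ m=\sum_{(h)} m\circ\bigl(a(h_{(0)})\otimes a(h_{(1)})\bigr)$ for all $h\in H$, where $\delta(h)=\sum_{(h)}h_{(0)}\otimes h_{(1)}$ is the coproduct of $H$. Assume that the action is faithful, that is, that $a$ is injective. Then $H$ is the group algebra of a group of automorphisms of $A$: there are a subgroup $G\subset\mathrm{Aut}_{\mathrm{alg}}(A)$ of the group of algebra automorphisms of $A$ and an isomorphism of Hopf algebras $\varphi\colon k[G]\to H$ such that $a(\varphi(g))=g$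 as a morphism $A\to A$ for every $g\in G$. -/

import Mathlib

open CategoryTheory MonoidalCategory
open scoped MonObj

universe w x v u

/-- A separable algebra: the multiplication `A ⊗ A ⟶ A` has a section which is a morphism
of `A`-bimodules. -/
def IsSeparableAlgObj {C : Type u} [Category.{v} C] [MonoidalCategory C] (A : C) [MonObj A] :
    Prop :=
  ∃ σ : A ⟶ A ⊗ A,
    σ ≫ μ[A] = 𝟙 A ∧
    μ[A] ≫ σ = (A ◁ σ) ≫ (α_ A A A).inv ≫ (μ[A] ▷ A) ∧
    μ[A] ≫ σ = (σ ▷ A) ≫ (α_ A A A).hom ≫ (A ◁ μ[A])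

/-- A connected algebra over `k`: the space of morphisms from the unit object to `A` is
one-dimensional. -/
def IsConnectedAlgObj (k : Type w) [Field k] {C : Type u} [Category.{v} C] [Preadditive C]
    [Linear k C] [MonoidalCategory C] (A : C) : Prop :=
  Module.finrank k (𝟙_ C ⟶ A) = 1

/-- An étale algebra in a `k`-linear braided monoidal category: commutative, separable and
connected. -/
structure IsEtaleAlgObj (k : Type w) [Field k] {C : Type u} [Category.{v} C] [Preadditive C]
    [Linear k C] [MonoidalCategory C] [BraidedCategory C] (A : C) [MonObj A] : Prop where
  comm : (β_ A A).hom ≫ μ[A] = μ[A]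
  separable : IsSeparableAlgObj A
  connected : IsConnectedAlgObj k A

/-- The linear map `C(A, A) ⊗ C(A, A) → C(A ⊗ A, A ⊗ A)`, `f ⊗ g ↦ f ⊗ₘ g`. -/
noncomputable def endTensorEnd (k : Type w) [Field k] {C : Type u} [Category.{v} C]
    [Preadditive C] [Linear k C] [MonoidalCategory C] [MonoidalPreadditive C]
    [MonoidalLinear k C] (A : C) :
    TensorProduct k (End A) (End A) →ₗ[k] End (A ⊗ A) :=
  TensorProduct.lift
    (LinearMap.mk₂ k (fun f g : End A => End.of (End.asHom f ⊗ₘ End.asHom g))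
      (fun f₁ f₂ g => MonoidalPreadditive.add_tensor (End.asHom f₁) (End.asHom f₂) (End.asHom g))
      (fun c f g => by
        change (c • End.asHom f) ⊗ₘ End.asHom g = c • (End.asHom f ⊗ₘ End.asHom g)
        simp [MonoidalCategory.tensorHom_def])
      (fun f g₁ g₂ => MonoidalPreadditive.tensor_add (End.asHom f) (End.asHom g₁) (End.asHom g₂))
      (fun c f g => by
        change End.asHom f ⊗ₘ (c • End.asHom g) = c • (End.asHom f ⊗ₘ End.asHom g)
        simp [MonoidalCategory.tensorHom_def]))

/-- An action of a bialgebra `H` on an algebra `A` in a `k`-linear monoidal category, written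
as a homomorphism of `k`-algebras `H → C(A, A)`, where the product of `C(A, A)` is the
composition `f * g = f ∘ g`. The multiplication of `A` satisfies
`h ∘ μ = ∑ μ ∘ (h₍₀₎ ⊗ h₍₁₎)` in Sweedler's notation for the coproduct of `H`. -/
structure BialgebraAction (k : Type w) [Field k] {C : Type u} [Category.{v} C]
    [Preadditive C] [Linear k C] [MonoidalCategory C] [MonoidalPreadditive C]
    [MonoidalLinear k C] (H : Type x) [Ring H] [Bialgebra k H] (A : C) [MonObj A] where
  toEnd : H →ₐ[k] End A
  mul_act : ∀ h : H,
    μ[A] ≫ End.asHom (toEnd h) =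
      End.asHom (endTensorEnd k A
        (TensorProduct.map toEnd.toLinearMap toEnd.toLinearMap (Coalgebra.comul h))) ≫ μ[A]

/-- An action is faithful if the corresponding map `H → C(A, A)` is injective. -/
def BialgebraAction.IsFaithful {k : Type w} [Field k] {C : Type u} [Category.{v} C]
    [Preadditive C] [Linear k C] [MonoidalCategory C] [MonoidalPreadditive C]
    [MonoidalLinear k C] {H : Type x} [Ring H] [Bialgebra k H] {A : C} [MonObj A]
    (a : BialgebraAction k H A) : Prop :=
  Function.Injective a.toEnd

/-- The group of algebra automorphisms of `A`, with product `g * h = g ∘ h`. -/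
abbrev AutAlg {C : Type u} [Category.{v} C] [MonoidalCategory C] (A : C) [MonObj A] : Type v :=
  Aut (Mon.mk A)

/-!
Let `σ` be the bimodule section of the multiplication of `A` and `e = σ ∘ η : 𝟙_ C ⟶ A ⊗ A`. Since
`A` is connected, `m ∘ (a(h) ⊗ a(x)) ∘ e = B(h, x) η` defines a bilinear form `B` on `H`.
Faithfulness turns the bimodule property of `σ` into the statement that `B` is a coseparability
form for the coalgebra `H`, while `m ∘ e = η` and `a(u) ∘ η = ε(u) η` give
`B(uh, x) = B(h, S(u)x)`; together these make `B` nondegenerate. Commutativity of `A` says that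
`a(h) ∘ m` does not see the order of the factors of `Δ(h)`, and nondegeneracy of `B` allows one to
conclude that `H` is cocommutative.

On a cocommutative coseparable coalgebra the commuting operators `f ⇀ -`, for `f` in the dual, are
strongly von Neumann regular (`F = r F ^ 2`), so their generalized eigenspaces are eigenspaces. They
preserve the finite-dimensional spaces `{f ⇀ h}`, on which they are therefore simultaneously
diagonalizable over an algebraically closed field. A common eigenvector is a multiple of a
group-like element, so `H` is spanned by its group-like elements, and these act on `A` by algebra
automorphisms.
-/

section LinearAlgebra

open TensorProduct Module

variable {R V W X : Type*} [CommRing R] [AddCommGroup V] [Module R V] [Module.Free R V]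
  [AddCommGroup W] [Module R W] [AddCommGroup X] [Module R X]

lemma lTensor_eq_lTensor_of_flip (B : W →ₗ[R] Dual R X) {s t : V ⊗[R] W}
    (hst : ∀ x, (B.flip x).lTensor V s = (B.flip x).lTensor V t) :
    B.lTensor V s = B.lTensor V t := by
  classical
  let b := Module.Free.chooseBasis R V
  have coord_lTensor (u : V ⊗[R] W) (i) (x : X) :
      TensorProduct.equivFinsuppOfBasisLeft b (B.lTensor V u) i x =
        b.coord i (TensorProduct.rid R V ((B.flip x).lTensor V u)) := by
    induction u with
    | zero => simp
    | add s t hs ht => simp only [map_add, Finsupp.add_apply, LinearMap.add_apply, hs, ht]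
    | tmul v w => simp [mul_comm]
  refine (TensorProduct.equivFinsuppOfBasisLeft b).injective (Finsupp.ext fun i => ?_)
  ext x
  rw [coord_lTensor, coord_lTensor, hst]

lemma eq_of_forall_lTensor_flip_eq {B : W →ₗ[R] Dual R X} (hB : Function.Injective B)
    {s t : V ⊗[R] W} (hst : ∀ x, (B.flip x).lTensor V s = (B.flip x).lTensor V t) : s = t :=
  Module.Flat.lTensor_preserves_injective_linearMap B hB (lTensor_eq_lTensor_of_flip B hst)

lemma eq_of_forall_lTensor_dual_eq [Module.Projective R W] {s t : V ⊗[R] W}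
    (hst : ∀ f : Dual R W, f.lTensor V s = f.lTensor V t) : s = t :=
  eq_of_forall_lTensor_flip_eq (eval_apply_injective (V := W) R) hst

lemma exists_comp_comp_eq_self {K V W : Type*} [DivisionRing K] [AddCommGroup V] [Module K V]
    [AddCommGroup W] [Module K W] (F : V →ₗ[K] W) : ∃ q : W →ₗ[K] V, F ∘ₗ q ∘ₗ F = F := by
  obtain ⟨q₀, hq₀⟩ := F.rangeRestrict.exists_rightInverse_of_surjective F.range_rangeRestrict
  obtain ⟨q, hq⟩ := LinearMap.exists_extend q₀
  refine ⟨q, LinearMap.ext fun x => ?_⟩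
  have q_apply : q (F x) = q₀ (F.rangeRestrict x) := LinearMap.congr_fun hq (F.rangeRestrict x)
  have section_apply := congrArg Subtype.val (LinearMap.congr_fun hq₀ (F.rangeRestrict x))
  simpa [q_apply] using section_apply

lemma eq_pow_mul_pow_succ_of_eq_mul_sq {M : Type*} [Monoid M] {r x : M} (hx : x = r * x ^ 2)
    (n : ℕ) : x = r ^ n * x ^ (n + 1) := by
  induction n with
  | zero => simp
  | succ n ih =>
    calc x = r ^ n * x ^ (n + 1) := ih
      _ = r ^ n * (x * x ^ n) := by rw [pow_succ']
      _ = r ^ n * (r * x ^ 2 * x ^ n) := by rw [← hx]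
      _ = r ^ (n + 1) * x ^ (n + 1 + 1) := by
        rw [pow_succ r, mul_assoc r, ← pow_add, add_comm 2 n, mul_assoc]

end LinearAlgebra

section Coalgebra

open Coalgebra (comul counit coassoc_apply)
open TensorProduct Module
open scoped Coalgebra

variable {R H : Type*} [CommSemiring R] [AddCommMonoid H] [Module R H] [Coalgebra R H]

/-- The left action `f ⇀ h = ∑ f(h₍₁₎) h₍₀₎` of the convolution algebra `Dual R H` on a
coalgebra `H`, as a bilinear map. -/
noncomputable def leftHit : Dual R H →ₗ[R] H →ₗ[R] H :=
  LinearMap.mk₂ R (fun f h => TensorProduct.rid R H (f.lTensor H (comul h)))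
    (by simp [LinearMap.lTensor_add]) (by simp [LinearMap.lTensor_smul]) (by simp) (by simp)

/-- The right action `h ↼ f = ∑ f(h₍₀₎) h₍₁₎` of the convolution algebra `Dual R H` on a
coalgebra `H`, as a bilinear map whose first argument is the functional. -/
noncomputable def rightHit : Dual R H →ₗ[R] H →ₗ[R] H :=
  LinearMap.mk₂ R (fun f h => TensorProduct.lid R H (f.rTensor H (comul h)))
    (by simp [LinearMap.rTensor_add]) (by simp [LinearMap.rTensor_smul]) (by simp) (by simp)

local notation:70 f:71 "⇀" h:71 => leftHit f h
local notation:70 h:71 "↼" f:71 => rightHit f h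

lemma leftHit_apply (f : Dual R H) (h : H) :
    f ⇀ h = TensorProduct.rid R H (f.lTensor H (comul h)) := rfl

lemma rightHit_apply (f : Dual R H) (h : H) :
    h ↼ f = TensorProduct.lid R H (f.rTensor H (comul h)) := rfl

lemma counit_leftHit (h : H) : (counit : Dual R H) ⇀ h = h := by simp [leftHit_apply]

lemma rightHit_counit (h : H) : h ↼ (counit : Dual R H) = h := by simp [rightHit_apply]

lemma dual_apply_rightHit (f g : Dual R H) (h : H) : g (h ↼ f) = f (g ⇀ h) := by
  have swap (t : H ⊗[R] H) : g (TensorProduct.lid R H (f.rTensor H t)) =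
      f (TensorProduct.rid R H (g.lTensor H t)) := by
    induction t with
    | zero => simp
    | add s t hs ht => simp only [map_add, hs, ht]
    | tmul x y => simp [mul_comm]
  exact swap _

lemma counit_apply_leftHit (f : Dual R H) (h : H) : counit (R := R) (f ⇀ h) = f h := by
  rw [← dual_apply_rightHit, rightHit_counit]

lemma counit_apply_rightHit (f : Dual R H) (h : H) : counit (R := R) (h ↼ f) = f h := by
  rw [dual_apply_rightHit, counit_leftHit]

lemma comul_leftHit (f : Dual R H) (h : H) :
    comul (f ⇀ h) = (leftHit f).lTensor H (comul (R := R) h) := by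
  let contract : H ⊗[R] H →ₗ[R] H := (TensorProduct.rid R H).toLinearMap ∘ₗ f.lTensor H
  have contract_assoc_tmul (z : H ⊗[R] H) (y : H) :
      contract.lTensor H (TensorProduct.assoc R H H H (z ⊗ₜ y)) = f y • z := by
    induction z with
    | zero => simp
    | add s t hs ht => simp only [TensorProduct.add_tmul, map_add, hs, ht, smul_add]
    | tmul u v => simp [contract]
  have comul_contract (t : H ⊗[R] H) : comul (contract t) =
      contract.lTensor H (TensorProduct.assoc R H H H ((comul (R := R)).rTensor H t)) := by
    induction t with
    | zero => simp
    | add s t hs ht => simp only [map_add, hs, ht]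
    | tmul u v => rw [LinearMap.rTensor_tmul, contract_assoc_tmul]; simp [contract]
  calc comul (f ⇀ h) = contract.lTensor H (comul.lTensor H (comul h)) := by
        rw [← coassoc_apply]; exact comul_contract _
    _ = (leftHit f).lTensor H (comul (R := R) h) := by
        rw [← LinearMap.comp_apply, ← LinearMap.lTensor_comp]; rfl

lemma leftHit_rightHit (f g : Dual R H) (h : H) : f ⇀ (h ↼ g) = (f ⇀ h) ↼ g := by
  have natural (t : H ⊗[R] H) : TensorProduct.lid R H (g.rTensor H ((leftHit f).lTensor H t)) =
      leftHit f (TensorProduct.lid R H (g.rTensor H t)) := by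
    induction t with
    | zero => simp
    | add s t hs ht => simp only [map_add, hs, ht]
    | tmul u v => simp
  rw [rightHit_apply g (f ⇀ h), comul_leftHit, natural, ← rightHit_apply]

lemma leftHit_leftHit (f g : Dual R H) (h : H) : f ⇀ (g ⇀ h) = (f ∘ₗ leftHit g) ⇀ h := by
  rw [leftHit_apply f, comul_leftHit, leftHit_apply, LinearMap.lTensor_comp, LinearMap.comp_apply]

section Cocommutative

variable [Coalgebra.IsCocomm R H]

lemma rightHit_eq_leftHit (f : Dual R H) (h : H) : h ↼ f = f ⇀ h := by
  have swap (t : H ⊗[R] H) : TensorProduct.lid R H (f.rTensor H (TensorProduct.comm R H H t)) =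
      TensorProduct.rid R H (f.lTensor H t) := by
    induction t with
    | zero => simp
    | add s t hs ht => simp only [map_add, hs, ht]
    | tmul u v => simp
  rw [rightHit_apply, ← Coalgebra.comm_comul, swap, ← leftHit_apply]

lemma leftHit_comm (f g : Dual R H) (h : H) : f ⇀ (g ⇀ h) = g ⇀ (f ⇀ h) := by
  rw [← rightHit_eq_leftHit g h, leftHit_rightHit, rightHit_eq_leftHit]

lemma comul_leftHit_eq_rTensor (f : Dual R H) (h : H) :
    comul (f ⇀ h) = (leftHit f).rTensor H (comul (R := R) h) := by
  rw [← Coalgebra.comm_comul, comul_leftHit, ← LinearMap.comm_comp_lTensor_comp_comm_eq]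
  simp

end Cocommutative

/-- A coseparability form (cointegral) on a coalgebra: a bilinear form `B` with
`∑ B(h₍₁₎, x) h₍₀₎ = ∑ B(h, x₍₀₎) x₍₁₎` and `∑ B(h₍₀₎, h₍₁₎) = ε(h)`. -/
structure IsCoseparabilityForm (B : H →ₗ[R] Dual R H) : Prop where
  leftHit_flip_apply : ∀ h x : H, leftHit (B.flip x) h = rightHit (B h) x
  lift_comul : ∀ h : H, TensorProduct.lift B (comul h) = counit (R := R) h

/-- The map `H ⊗ H → H`, `x ⊗ y ↦ ∑ B(x₍₁₎, y) x₍₀₎`. For a coseparability form `B` it is a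
bicomodule retraction of the comultiplication. -/
noncomputable def comulRetraction (B : H →ₗ[R] Dual R H) : H ⊗[R] H →ₗ[R] H :=
  TensorProduct.lift (leftHit ∘ₗ B.flip).flip

lemma comulRetraction_tmul (B : H →ₗ[R] Dual R H) (x y : H) :
    comulRetraction B (x ⊗ₜ y) = B.flip y ⇀ x := rfl

lemma comulRetraction_rTensor_rightHit (B : H →ₗ[R] Dual R H) (f : Dual R H) (t : H ⊗[R] H) :
    comulRetraction B ((rightHit f).rTensor H t) = comulRetraction B t ↼ f := by
  induction t with
  | zero => simp
  | add s t hs ht => simp only [map_add, hs, ht]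
  | tmul x y =>
    rw [LinearMap.rTensor_tmul, comulRetraction_tmul, comulRetraction_tmul, leftHit_rightHit]

namespace IsCoseparabilityForm

variable {B : H →ₗ[R] Dual R H} (hB : IsCoseparabilityForm B)
include hB

lemma comulRetraction_lTensor_leftHit (f : Dual R H) (t : H ⊗[R] H) :
    comulRetraction B ((leftHit f).lTensor H t) = f ⇀ comulRetraction B t := by
  induction t with
  | zero => simp
  | add s t hs ht => simp only [map_add, hs, ht]
  | tmul x y =>
    rw [LinearMap.lTensor_tmul, comulRetraction_tmul, comulRetraction_tmul,
      hB.leftHit_flip_apply, hB.leftHit_flip_apply, leftHit_rightHit]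

lemma comulRetraction_comul (h : H) : comulRetraction B (comul h) = h := by
  have retraction_tmul (z : H ⊗[R] H) (y : H) :
      TensorProduct.rid R H ((TensorProduct.lift B).lTensor H
        (TensorProduct.assoc R H H H (z ⊗ₜ y))) =
      TensorProduct.rid R H ((B.flip y).lTensor H z) := by
    induction z with
    | zero => simp
    | add s t hs ht => simp only [TensorProduct.add_tmul, map_add, hs, ht]
    | tmul u v => simp
  have retraction_eq (t : H ⊗[R] H) : comulRetraction B t =
      TensorProduct.rid R H ((TensorProduct.lift B).lTensor H
        (TensorProduct.assoc R H H H (comul.rTensor H t))) := by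
    induction t with
    | zero => simp
    | add s t hs ht => simp only [map_add, hs, ht]
    | tmul x y => rw [LinearMap.rTensor_tmul, retraction_tmul]; rfl
  have lift_comp_comul : TensorProduct.lift B ∘ₗ comul = counit (R := R) (A := H) :=
    LinearMap.ext hB.lift_comul
  rw [retraction_eq, coassoc_apply, ← LinearMap.comp_apply, ← LinearMap.lTensor_comp,
    lift_comp_comul, ← leftHit_apply, counit_leftHit]

end IsCoseparabilityForm

lemma leftHit_sub_smul_counit {R H : Type*} [CommRing R] [AddCommGroup H] [Module R H]
    [Coalgebra R H] (f : Dual R H) (c : R) :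
    leftHit (f - c • counit) = leftHit f - (c • 1 : Module.End R H) := by
  ext h
  simp [counit_leftHit]

section Field

variable {k H : Type*} [Field k] [AddCommGroup H] [Module k H] [Coalgebra k H]

namespace IsCoseparabilityForm

variable [Coalgebra.IsCocomm k H] {B : H →ₗ[k] Dual k H} (hB : IsCoseparabilityForm B)
include hB

lemma exists_leftHit_eq_mul_sq (f : Dual k H) :
    ∃ r : Module.End k H, leftHit f = r * leftHit f ^ 2 := by
  let F : Module.End k H := leftHit f
  let D := comulRetraction B
  obtain ⟨q, hq⟩ := exists_comp_comp_eq_self F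
  refine ⟨D ∘ₗ q.lTensor H ∘ₗ comul, LinearMap.ext fun v => ?_⟩
  calc F v = D (F.lTensor H (comul v)) := by
        rw [← comul_leftHit, hB.comulRetraction_comul]
    _ = D (F.lTensor H (q.lTensor H (comul (F v)))) := by
        rw [comul_leftHit, ← LinearMap.lTensor_comp_apply, ← LinearMap.lTensor_comp_apply,
          LinearMap.comp_assoc, hq]
    _ = D (F.rTensor H (q.lTensor H (comul (F v)))) := by
        rw [hB.comulRetraction_lTensor_leftHit, ← rightHit_eq_leftHit,
          ← comulRetraction_rTensor_rightHit, LinearMap.ext (rightHit_eq_leftHit f)]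
    _ = D (q.lTensor H (comul (F (F v)))) := by
        rw [comul_leftHit_eq_rTensor f (F v), ← LinearMap.comp_apply (F.rTensor H),
          LinearMap.rTensor_comp_lTensor, ← LinearMap.lTensor_comp_rTensor, LinearMap.comp_apply]
    _ = (D ∘ₗ q.lTensor H ∘ₗ comul * F ^ 2) v := by rw [sq]; rfl

lemma maxGenEigenspace_leftHit (f : Dual k H) (c : k) :
    Module.End.maxGenEigenspace (leftHit f) c = Module.End.eigenspace (leftHit f) c := by
  refine le_antisymm (fun v hv => ?_) ((Module.End.genEigenspace _ _).monotone le_top)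
  obtain ⟨n, hn⟩ := (Module.End.mem_maxGenEigenspace _ _ _).1 hv
  obtain ⟨r, hr⟩ := hB.exists_leftHit_eq_mul_sq (f - c • counit)
  rw [leftHit_sub_smul_counit] at hr
  rw [Module.End.eigenspace_def, LinearMap.mem_ker, eq_pow_mul_pow_succ_of_eq_mul_sq hr n,
    pow_succ', Module.End.mul_apply, Module.End.mul_apply, hn, map_zero, map_zero]

end IsCoseparabilityForm

section GroupLike

open Submodule (span)

lemma mem_span_isGroupLikeElem_of_forall_leftHit_eq_smul {χ : Dual k H → k} {v : H}
    (hv : ∀ f : Dual k H, f ⇀ v = χ f • v) : v ∈ span k {g : H | IsGroupLikeElem k g} := by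
  obtain rfl | hv0 := eq_or_ne v 0
  · exact zero_mem _
  obtain ⟨φ, hφ⟩ := Module.Projective.exists_dual_eq_one k hv0
  let g := v ↼ φ
  have leftHit_g (f : Dual k H) : f ⇀ g = χ f • g := by
    rw [leftHit_rightHit, hv, map_smul]
  have dual_apply_g (f : Dual k H) : f g = χ f := by
    rw [dual_apply_rightHit, hv, map_smul, hφ, smul_eq_mul, mul_one]
  have isGroupLikeElem_g : IsGroupLikeElem k g := by
    refine ⟨by rw [counit_apply_rightHit, hφ], eq_of_forall_lTensor_dual_eq fun f =>
      (TensorProduct.rid k H).injective ?_⟩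
    rw [← leftHit_apply, leftHit_g, LinearMap.lTensor_tmul, dual_apply_g, TensorProduct.rid_tmul]
  have v_eq : v = counit (R := k) v • g := by
    refine eval_apply_injective k (LinearMap.ext fun f => ?_)
    rw [Dual.eval_apply, Dual.eval_apply, ← counit_apply_leftHit, hv, map_smul, map_smul,
      dual_apply_g, smul_eq_mul, smul_eq_mul, mul_comm]
  rw [v_eq]
  exact Submodule.smul_mem _ _ (Submodule.subset_span isGroupLikeElem_g)

instance finiteDimensional_range_leftHit_flip (h : H) :
    FiniteDimensional k (LinearMap.range (leftHit (R := k).flip h)) := by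
  let 𝓡 := ℛ k h
  have range_le : LinearMap.range (leftHit (R := k).flip h) ≤
      span k (𝓡.left '' 𝓡.index) := by
    rintro _ ⟨f, rfl⟩
    rw [LinearMap.flip_apply, leftHit_apply, ← 𝓡.eq]
    simp only [map_sum, LinearMap.lTensor_tmul, TensorProduct.rid_tmul]
    exact Submodule.sum_mem _ fun i hi =>
      Submodule.smul_mem _ _ (Submodule.subset_span ⟨i, hi, rfl⟩)
  have := FiniteDimensional.span_of_finite k (𝓡.index.finite_toSet.image 𝓡.left)
  exact Submodule.finiteDimensional_of_le range_le

lemma mapsTo_leftHit_range_leftHit_flip (f : Dual k H) (h : H) :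
    Set.MapsTo (leftHit f) (LinearMap.range (leftHit (R := k).flip h))
      (LinearMap.range (leftHit (R := k).flip h)) := by
  rintro _ ⟨g, rfl⟩
  exact ⟨f ∘ₗ leftHit g, (leftHit_leftHit f g h).symm⟩

theorem IsCoseparabilityForm.span_isGroupLikeElem_eq_top [IsAlgClosed k]
    [Coalgebra.IsCocomm k H] {B : H →ₗ[k] Dual k H} (hB : IsCoseparabilityForm B) :
    span k {g : H | IsGroupLikeElem k g} = ⊤ := by
  refine eq_top_iff.2 fun h _ => ?_
  let W := LinearMap.range (leftHit (R := k).flip h)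
  let F (f : Dual k H) : Module.End k W :=
    (leftHit f).restrict (mapsTo_leftHit_range_leftHit_flip f h)
  have iSup_eq_top : ⨆ χ : Dual k H → k, ⨅ f, (F f).maxGenEigenspace (χ f) = ⊤ :=
    Module.End.iSup_iInf_maxGenEigenspace_eq_top_of_iSup_maxGenEigenspace_eq_top_of_commute F
      (fun f g _ => LinearMap.ext fun w => Subtype.ext (leftHit_comm f g w))
      (fun f => Module.End.iSup_maxGenEigenspace_eq_top (F f))
  have iSup_le_span : ⨆ χ : Dual k H → k, ⨅ f, (F f).maxGenEigenspace (χ f) ≤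
      (span k {g : H | IsGroupLikeElem k g}).comap W.subtype := by
    refine iSup_le fun χ w hw => mem_span_isGroupLikeElem_of_forall_leftHit_eq_smul (χ := χ)
      fun f => Module.End.mem_eigenspace_iff.1 ?_
    exact (hB.maxGenEigenspace_leftHit f (χ f)).le
      ((Module.End.genEigenspace_restrict (leftHit f) W ⊤ (χ f) _).le
        ((Submodule.mem_iInf _).1 hw f))
  exact iSup_le_span (iSup_eq_top.ge (Submodule.mem_top (x := ⟨h, counit, counit_leftHit h⟩)))

end GroupLike

end Field

end Coalgebra

section HopfAlgebra

open Coalgebra (comul counit coassoc_apply)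
open HopfAlgebra (antipode)
open TensorProduct Module

section Semiring

variable {R H : Type*} [CommSemiring R] [Semiring H] [HopfAlgebra R H]

lemma lTensor_mul'_antipode_assoc_tmul (z : H ⊗[R] H) (v : H) :
    (LinearMap.mul' R H ∘ₗ (antipode R).lTensor H).lTensor H
      (TensorProduct.assoc R H H H (z ⊗ₜ v)) = z * (1 ⊗ₜ antipode R v) := by
  induction z with
  | zero => simp
  | add s t hs ht => simp only [TensorProduct.add_tmul, map_add, hs, ht, add_mul]
  | tmul x y => simp

lemma lTensor_mul'_antipode_assoc_rTensor_comul (u : H) :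
    (LinearMap.mul' R H ∘ₗ (antipode R).lTensor H).lTensor H
      (TensorProduct.assoc R H H H (comul.rTensor H (comul u))) = u ⊗ₜ[R] 1 := by
  rw [coassoc_apply, ← LinearMap.lTensor_comp_apply, LinearMap.comp_assoc,
    HopfAlgebra.mul_antipode_lTensor_comul, LinearMap.lTensor_comp_apply,
    Coalgebra.lTensor_counit_comul]
  simp

lemma apply_mul_eq_apply_antipode_mul {B : H →ₗ[R] Dual R H}
    (hB : ∀ u h x : H, TensorProduct.lift B (comul u * h ⊗ₜ[R] x) = counit (R := R) u * B h x)
    (u h x : H) : B (u * h) x = B h (antipode R u * x) := by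
  have lift_comul_mul (t : H ⊗[R] H) :
      TensorProduct.lift B ((LinearMap.mul' R H ∘ₗ (antipode R).lTensor H).lTensor H
        (TensorProduct.assoc R H H H (comul.rTensor H t)) * h ⊗ₜ x) =
      B h (antipode R (TensorProduct.lid R H (counit.rTensor H t)) * x) := by
    induction t with
    | zero => simp
    | add s t hs ht => simp only [map_add, hs, ht, add_mul]
    | tmul v w =>
      rw [LinearMap.rTensor_tmul, lTensor_mul'_antipode_assoc_tmul, mul_assoc,
        Algebra.TensorProduct.tmul_mul_tmul, one_mul, hB]
      simp
  have form_eq := lift_comul_mul (comul u)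
  rwa [lTensor_mul'_antipode_assoc_rTensor_comul, Algebra.TensorProduct.tmul_mul_tmul, one_mul,
    TensorProduct.lift.tmul, Coalgebra.rTensor_counit_comul, TensorProduct.lid_tmul,
    one_smul] at form_eq

end Semiring

/-- If `B h = 0` then `Δ(h) ∈ H ⊗ ker B`; by adjointness `ker B` is a left ideal, so that
`ε(h) 1 = ∑ S(h₍₀₎) h₍₁₎` lies in `ker B` and `ε(h) = ε(h) B(1, 1) = 0`. -/
lemma IsCoseparabilityForm.injective {R H : Type*} [CommRing R] [Ring H] [HopfAlgebra R H]
    [Module.Free R H] {B : H →ₗ[R] Dual R H} (hB : IsCoseparabilityForm B)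
    (hadj : ∀ u h x : H, B (u * h) x = B h (antipode R u * x)) : Function.Injective B := by
  have form_one_one : B 1 1 = 1 := by
    simpa [Algebra.TensorProduct.one_def] using hB.lift_comul 1
  let G : H ⊗[R] Dual R H →ₗ[R] Dual R H := TensorProduct.lift
    ((LinearMap.llcomp R H H R).flip ∘ₗ LinearMap.mul R H ∘ₗ antipode R ∘ₗ antipode R)
  have form_antipode_mul (t : H ⊗[R] H) :
      B (LinearMap.mul' R H ((antipode R).rTensor H t)) = G (B.lTensor H t) := by
    induction t with
    | zero => simp
    | add s t hs ht => simp only [map_add, hs, ht]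
    | tmul u v => ext x; simp [G, hadj]
  have counit_eq_zero {h : H} (hh : B h = 0) : counit (R := R) h = 0 := by
    have lTensor_comul_eq_zero : B.lTensor H (comul h) = B.lTensor H 0 := by
      refine lTensor_eq_lTensor_of_flip B fun x => (TensorProduct.rid R H).injective ?_
      rw [← leftHit_apply, hB.leftHit_flip_apply, hh]
      simp
    have counit_smul_one := form_antipode_mul (comul h)
    rw [lTensor_comul_eq_zero, HopfAlgebra.mul_antipode_rTensor_comul_apply,
      Algebra.algebraMap_eq_smul_one] at counit_smul_one
    simpa [form_one_one] using LinearMap.congr_fun counit_smul_one 1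
  rw [← LinearMap.ker_eq_bot, eq_bot_iff]
  intro h (hh : B h = 0)
  refine (forall_dual_apply_eq_zero_iff R h).1 fun f => ?_
  rw [← counit_apply_rightHit f h]
  refine counit_eq_zero (LinearMap.ext fun x => ?_)
  rw [← LinearMap.flip_apply, dual_apply_rightHit, hB.leftHit_flip_apply, hh]
  simp

end HopfAlgebra

section MonoidAlgebra

variable {R H : Type*} [CommRing R] [IsDomain R] [Ring H] [Bialgebra R H] [Module.IsTorsionFree R H]

lemma liftGroupLikeBialgHom_bijective
    (hH : Submodule.span R {g : H | IsGroupLikeElem R g} = ⊤) :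
    Function.Bijective (MonoidAlgebra.liftGroupLikeBialgHom (R := R) (A := H)) := by
  have lift_eq_linearCombination (x : MonoidAlgebra R (GroupLike R H)) :
      MonoidAlgebra.liftGroupLikeBialgHom x =
        Finsupp.linearCombination R (GroupLike.val (R := R) (A := H)) x.coeff := by
    rw [Finsupp.linearCombination_apply]
    exact MonoidAlgebra.lift_apply _ _
  have range_val : Set.range (GroupLike.val (R := R) (A := H)) = {g | IsGroupLikeElem R g} :=
    Set.ext fun g => ⟨by rintro ⟨g, rfl⟩; exact g.2, fun hg => ⟨⟨g, hg⟩, rfl⟩⟩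
  refine ⟨fun x y hxy => ?_, fun h => ?_⟩
  · rw [lift_eq_linearCombination, lift_eq_linearCombination] at hxy
    exact MonoidAlgebra.coeff_injective (linearIndep_groupLikeVal hxy)
  · rw [← range_val] at hH
    obtain ⟨f, rfl⟩ := Finsupp.mem_span_range_iff_exists_finsupp.1
      (hH.ge (Submodule.mem_top (x := h)))
    exact ⟨MonoidAlgebra.ofCoeff f, lift_eq_linearCombination _⟩

end MonoidAlgebra

section ExternalProduct

variable {C : Type u} [Category.{v} C] [MonoidalCategory C] {A X Y Z : C} [MonObj A]

/-- The external product `μ ∘ (f ⊗ g)` of two generalized elements `f : X ⟶ A` and `g : Y ⟶ A`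
of an algebra, written `f ⊙ g`. -/
def extMul (f : X ⟶ A) (g : Y ⟶ A) : X ⊗ Y ⟶ A := (f ⊗ₘ g) ≫ μ[A]

local notation:81 f:81 "⊙" g:82 => extMul f g

lemma tensorHom_comp_extMul {X' Y' : C} (p : X' ⟶ X) (q : Y' ⟶ Y) (f : X ⟶ A) (g : Y ⟶ A) :
    (p ⊗ₘ q) ≫ f ⊙ g = (p ≫ f) ⊙ (q ≫ g) :=
  tensorHom_comp_tensorHom_assoc ..

lemma whiskerLeft_comp_extMul {Y' : C} (q : Y' ⟶ Y) (f : X ⟶ A) (g : Y ⟶ A) :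
    X ◁ q ≫ f ⊙ g = f ⊙ (q ≫ g) := by
  rw [← id_tensorHom, tensorHom_comp_extMul, Category.id_comp]

lemma whiskerRight_comp_extMul {X' : C} (p : X' ⟶ X) (f : X ⟶ A) (g : Y ⟶ A) :
    p ▷ Y ≫ f ⊙ g = (p ≫ f) ⊙ g := by
  rw [← tensorHom_id, tensorHom_comp_extMul, Category.id_comp]

lemma extMul_assoc (f : X ⟶ A) (g : Y ⟶ A) (h : Z ⟶ A) :
    f ⊙ g ⊙ h = (α_ X Y Z).hom ≫ f ⊙ (g ⊙ h) := by
  have extMul_comp : f ⊙ g ⊙ h = ((f ⊗ₘ g) ⊗ₘ h) ≫ μ[A] ▷ A ≫ μ[A] := by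
    rw [← tensorHom_id, tensorHom_comp_tensorHom_assoc, Category.comp_id]; rfl
  have extMul_comp' : f ⊙ (g ⊙ h) = (f ⊗ₘ (g ⊗ₘ h)) ≫ A ◁ μ[A] ≫ μ[A] := by
    rw [← id_tensorHom, tensorHom_comp_tensorHom_assoc, Category.comp_id]; rfl
  rw [extMul_comp, extMul_comp', MonObj.mul_assoc, associator_naturality_assoc]

lemma rightUnitor_inv_comp_extMul_one (f : X ⟶ A) : (ρ_ X).inv ≫ f ⊙ η[A] = f := by
  simp [extMul, MonoidalCategory.tensorHom_def]

lemma leftUnitor_inv_comp_one_extMul (f : X ⟶ A) : (λ_ X).inv ≫ η[A] ⊙ f = f := by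
  simp [extMul, MonoidalCategory.tensorHom_def']

lemma whiskerLeft_comp_associator_inv_comp_extMul (e : 𝟙_ C ⟶ Y ⊗ Z) (f : X ⟶ A) (g : Y ⟶ A)
    (h : Z ⟶ A) : X ◁ e ≫ (α_ X Y Z).inv ≫ f ⊙ g ⊙ h = f ⊙ (e ≫ g ⊙ h) := by
  rw [extMul_assoc, Iso.inv_hom_id_assoc, whiskerLeft_comp_extMul]

lemma whiskerRight_comp_associator_hom_comp_extMul (e : 𝟙_ C ⟶ X ⊗ Y) (f : X ⟶ A) (g : Y ⟶ A)
    (h : Z ⟶ A) : e ▷ Z ≫ (α_ X Y Z).hom ≫ f ⊙ (g ⊙ h) = (e ≫ f ⊙ g) ⊙ h := by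
  rw [← extMul_assoc, whiskerRight_comp_extMul]

lemma braiding_comp_extMul [BraidedCategory C] [IsCommMonObj A] (f : X ⟶ A) (g : Y ⟶ A) :
    (β_ X Y).hom ≫ g ⊙ f = f ⊙ g := by
  rw [extMul, extMul, ← BraidedCategory.braiding_naturality_assoc, IsCommMonObj.mul_comm]

lemma section_eq_whiskerLeft {σ : A ⟶ A ⊗ A}
    (hσ : μ[A] ≫ σ = A ◁ σ ≫ (α_ A A A).inv ≫ μ[A] ▷ A) :
    σ = (ρ_ A).inv ≫ A ◁ (η[A] ≫ σ) ≫ (α_ A A A).inv ≫ μ[A] ▷ A := by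
  rw [MonoidalCategory.whiskerLeft_comp, Category.assoc, ← hσ]
  simp

lemma section_eq_whiskerRight {σ : A ⟶ A ⊗ A}
    (hσ : μ[A] ≫ σ = σ ▷ A ≫ (α_ A A A).hom ≫ A ◁ μ[A]) :
    σ = (λ_ A).inv ≫ (η[A] ≫ σ) ▷ A ≫ (α_ A A A).hom ≫ A ◁ μ[A] := by
  rw [MonoidalCategory.comp_whiskerRight, Category.assoc, ← hσ]
  simp

section Linear

variable [Preadditive C] [MonoidalPreadditive C]

lemma zero_extMul (g : Y ⟶ A) : (0 : X ⟶ A) ⊙ g = 0 := by simp [extMul]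

lemma extMul_zero (f : X ⟶ A) : f ⊙ (0 : Y ⟶ A) = 0 := by simp [extMul]

lemma add_extMul (f₁ f₂ : X ⟶ A) (g : Y ⟶ A) : (f₁ + f₂) ⊙ g = f₁ ⊙ g + f₂ ⊙ g := by
  simp [extMul, MonoidalPreadditive.add_tensor]

lemma extMul_add (f : X ⟶ A) (g₁ g₂ : Y ⟶ A) : f ⊙ (g₁ + g₂) = f ⊙ g₁ + f ⊙ g₂ := by
  simp [extMul, MonoidalPreadditive.tensor_add]

variable {k : Type w} [Field k] [Linear k C] [MonoidalLinear k C]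

lemma smul_extMul (r : k) (f : X ⟶ A) (g : Y ⟶ A) : (r • f) ⊙ g = r • f ⊙ g := by
  simp [extMul, MonoidalCategory.tensorHom_def]

lemma extMul_smul (r : k) (f : X ⟶ A) (g : Y ⟶ A) : f ⊙ (r • g) = r • f ⊙ g := by
  simp [extMul, MonoidalCategory.tensorHom_def]

end Linear

namespace IsConnectedAlgObj

variable {k : Type w} [Field k] {C : Type u} [Category.{v} C] [Preadditive C] [Linear k C]
  [MonoidalCategory C] [MonoidalPreadditive C] {A : C} [MonObj A] (hA : IsConnectedAlgObj k A)

include hA in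
lemma one_ne_zero : η[A] ≠ 0 := by
  intro one_eq_zero
  have id_eq_zero : 𝟙 A = 0 := by
    rw [← cancel_epi (λ_ A).hom, Category.comp_id, ← MonObj.one_mul, one_eq_zero]
    simp
  have : Subsingleton (𝟙_ C ⟶ A) := ⟨fun f g => by
    rw [← Category.comp_id f, ← Category.comp_id g, id_eq_zero, Limits.comp_zero,
      Limits.comp_zero]⟩
  exact zero_ne_one (Module.finrank_zero_of_subsingleton.symm.trans hA)

/-- The coordinate of a morphism `𝟙_ C ⟶ A` with respect to the unit of a connected algebra. -/
noncomputable def coeff : (𝟙_ C ⟶ A) →ₗ[k] k :=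
  (Module.Projective.exists_dual_eq_one k hA.one_ne_zero).choose

lemma coeff_one : hA.coeff η[A] = 1 :=
  (Module.Projective.exists_dual_eq_one k hA.one_ne_zero).choose_spec

lemma coeff_smul_one (f : 𝟙_ C ⟶ A) : hA.coeff f • η[A] = f := by
  obtain ⟨r, rfl⟩ := exists_smul_eq_of_finrank_eq_one hA hA.one_ne_zero f
  rw [map_smul, hA.coeff_one, smul_eq_mul, mul_one]

end IsConnectedAlgObj

namespace BialgebraAction

open Coalgebra (comul counit)
open TensorProduct

variable {k : Type w} [Field k] {C : Type u} [Category.{v} C] [Preadditive C] [Linear k C]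
  [MonoidalCategory C] [MonoidalPreadditive C] [MonoidalLinear k C]
  {H : Type x} [Ring H] {A : C} [MonObj A]

section Bialgebra

variable [Bialgebra k H] (a : BialgebraAction k H A)

/-- The action as a linear map to the hom-space `A ⟶ A`. -/
def act : H →ₗ[k] (A ⟶ A) where
  toFun h := End.asHom (a.toEnd h)
  map_add' := map_add a.toEnd
  map_smul' := map_smul a.toEnd

lemma act_one : a.act 1 = 𝟙 A := map_one a.toEnd

lemma act_mul (g h : H) : a.act (g * h) = a.act h ≫ a.act g := map_mul a.toEnd g h

lemma IsFaithful.act_injective {a : BialgebraAction k H A} (ha : a.IsFaithful) :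
    Function.Injective a.act := ha

/-- The linear map `H ⊗ H → C(A ⊗ A, A)`, `f ⊗ g ↦ a(f) ⊙ a(g)`. -/
noncomputable def actMul : H ⊗[k] H →ₗ[k] (A ⊗ A ⟶ A) :=
  Linear.rightComp k (A ⊗ A) μ[A] ∘ₗ
    (endTensorEnd k A ∘ₗ TensorProduct.map a.toEnd.toLinearMap a.toEnd.toLinearMap :
      H ⊗[k] H →ₗ[k] End (A ⊗ A))

lemma actMul_tmul (f g : H) : a.actMul (f ⊗ₜ g) = a.act f ⊙ a.act g := rfl

lemma mul_comp_act (h : H) : μ[A] ≫ a.act h = a.actMul (comul h) := a.mul_act h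

lemma tensorHom_act_comp_actMul (h x : H) (t : H ⊗[k] H) :
    (a.act h ⊗ₘ a.act x) ≫ a.actMul t = a.actMul (t * h ⊗ₜ x) := by
  induction t with
  | zero => simp
  | add s t hs ht => simp only [map_add, Preadditive.comp_add, add_mul, hs, ht]
  | tmul f g =>
    rw [Algebra.TensorProduct.tmul_mul_tmul, actMul_tmul, actMul_tmul, tensorHom_comp_extMul,
      act_mul, act_mul]

/-- The compatibility of an action with the unit of the algebra, `a(h) ∘ η = ε(h) η`. -/
def IsUnital : Prop := ∀ h : H, η[A] ≫ a.act h = counit (R := k) h • η[A]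

section Connected

variable (hA : IsConnectedAlgObj k A)

/-- The bilinear form on `H` with `e ≫ a(h) ⊙ a(x) = B(h, x) η` for `e : 𝟙_ C ⟶ A ⊗ A`. -/
noncomputable def form (e : 𝟙_ C ⟶ A ⊗ A) : H →ₗ[k] Module.Dual k H :=
  TensorProduct.curry (hA.coeff ∘ₗ Linear.leftComp k A e ∘ₗ a.actMul)

lemma lift_form (e : 𝟙_ C ⟶ A ⊗ A) (t : H ⊗[k] H) :
    TensorProduct.lift (a.form hA e) t = hA.coeff (e ≫ a.actMul t) := by
  have lift_eq : TensorProduct.lift (a.form hA e) =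
      hA.coeff ∘ₗ Linear.leftComp k A e ∘ₗ a.actMul := TensorProduct.ext' fun _ _ => rfl
  exact LinearMap.congr_fun lift_eq t

lemma comp_act_extMul_act (e : 𝟙_ C ⟶ A ⊗ A) (h x : H) :
    e ≫ a.act h ⊙ a.act x = a.form hA e h x • η[A] :=
  (hA.coeff_smul_one _).symm

lemma whiskerLeft_one_comp_actMul (t : H ⊗[k] H) :
    (ρ_ A).inv ≫ A ◁ η[A] ≫ a.actMul t =
      a.act (TensorProduct.rid k H
        ((hA.coeff ∘ₗ Linear.leftComp k A η[A] ∘ₗ a.act).lTensor H t)) := by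
  induction t with
  | zero => simp
  | add s t hs ht => simp only [map_add, Preadditive.comp_add, hs, ht]
  | tmul f g =>
    rw [actMul_tmul, whiskerLeft_comp_extMul, ← hA.coeff_smul_one (η[A] ≫ a.act g), extMul_smul,
      Linear.comp_smul, rightUnitor_inv_comp_extMul_one]
    simp

lemma whiskerLeft_comp_actMul_extMul (e : 𝟙_ C ⟶ A ⊗ A) (x : H) (t : H ⊗[k] H) :
    (ρ_ A).inv ≫ A ◁ e ≫ (α_ A A A).inv ≫ a.actMul t ⊙ a.act x =
      a.act (TensorProduct.rid k H (((a.form hA e).flip x).lTensor H t)) := by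
  induction t with
  | zero => simp [zero_extMul]
  | add s t hs ht => simp only [map_add, Preadditive.comp_add, add_extMul, hs, ht]
  | tmul f g =>
    rw [actMul_tmul, whiskerLeft_comp_associator_inv_comp_extMul, a.comp_act_extMul_act hA,
      extMul_smul, Linear.comp_smul, rightUnitor_inv_comp_extMul_one]
    simp

lemma whiskerRight_comp_extMul_actMul (e : 𝟙_ C ⟶ A ⊗ A) (h : H) (t : H ⊗[k] H) :
    (λ_ A).inv ≫ e ▷ A ≫ (α_ A A A).hom ≫ a.act h ⊙ a.actMul t =
      a.act (TensorProduct.lid k H ((a.form hA e h).rTensor H t)) := by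
  induction t with
  | zero => simp [extMul_zero]
  | add s t hs ht => simp only [map_add, Preadditive.comp_add, extMul_add, hs, ht]
  | tmul f g =>
    rw [actMul_tmul, whiskerRight_comp_associator_hom_comp_extMul, a.comp_act_extMul_act hA,
      smul_extMul, Linear.comp_smul, leftUnitor_inv_comp_one_extMul]
    simp

variable {a}

include hA in
lemma IsFaithful.isUnital (ha : a.IsFaithful) : a.IsUnital := by
  intro h
  let χ : Module.Dual k H := hA.coeff ∘ₗ Linear.leftComp k A η[A] ∘ₗ a.act
  have leftHit_eq : leftHit χ h = h := by
    refine ha.act_injective ?_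
    rw [leftHit_apply, ← a.whiskerLeft_one_comp_actMul hA, ← mul_comp_act]
    simp
  have counit_eq : counit (R := k) h = χ h := by
    rw [← counit_apply_leftHit χ h, leftHit_eq]
  rw [counit_eq]
  exact (hA.coeff_smul_one _).symm

lemma IsUnital.lift_form_comul_mul (ha : a.IsUnital) (e : 𝟙_ C ⟶ A ⊗ A) (u h x : H) :
    TensorProduct.lift (a.form hA e) (comul u * h ⊗ₜ x) =
      counit (R := k) u * a.form hA e h x := by
  have comp_act : e ≫ a.actMul (comul u * h ⊗ₜ x) = (a.form hA e h x * counit (R := k) u) • η[A] :=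
    calc e ≫ a.actMul (comul u * h ⊗ₜ x)
        = (e ≫ a.act h ⊙ a.act x) ≫ a.act u := by
          rw [← tensorHom_act_comp_actMul, ← mul_comp_act, extMul]
          simp only [Category.assoc]
      _ = (a.form hA e h x * counit (R := k) u) • η[A] := by
          rw [a.comp_act_extMul_act hA, Linear.smul_comp, ha, smul_smul]
  rw [lift_form, comp_act, map_smul, hA.coeff_one, smul_eq_mul, mul_one, mul_comm]

lemma IsFaithful.isCoseparabilityForm (ha : a.IsFaithful) {σ : A ⟶ A ⊗ A}
    (hσ : σ ≫ μ[A] = 𝟙 A) (hl : μ[A] ≫ σ = A ◁ σ ≫ (α_ A A A).inv ≫ μ[A] ▷ A)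
    (hr : μ[A] ≫ σ = σ ▷ A ≫ (α_ A A A).hom ≫ A ◁ μ[A]) :
    IsCoseparabilityForm (a.form hA (η[A] ≫ σ)) where
  leftHit_flip_apply h x := by
    refine ha.act_injective ?_
    calc a.act (leftHit ((a.form hA (η[A] ≫ σ)).flip x) h)
        = ((ρ_ A).inv ≫ A ◁ (η[A] ≫ σ) ≫ (α_ A A A).inv ≫ μ[A] ▷ A) ≫ a.act h ⊙ a.act x := by
          rw [leftHit_apply, ← whiskerLeft_comp_actMul_extMul, ← mul_comp_act,
            ← whiskerRight_comp_extMul]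
          simp only [Category.assoc]
      _ = σ ≫ a.act h ⊙ a.act x := by rw [← section_eq_whiskerLeft hl]
      _ = ((λ_ A).inv ≫ (η[A] ≫ σ) ▷ A ≫ (α_ A A A).hom ≫ A ◁ μ[A]) ≫ a.act h ⊙ a.act x := by
          rw [← section_eq_whiskerRight hr]
      _ = a.act (rightHit (a.form hA (η[A] ≫ σ) h) x) := by
          rw [rightHit_apply, ← whiskerRight_comp_extMul_actMul, ← mul_comp_act,
            ← whiskerLeft_comp_extMul]
          simp only [Category.assoc]
  lift_comul h := by
    rw [lift_form, ← mul_comp_act, Category.assoc, reassoc_of% hσ, ha.isUnital hA, map_smul,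
      hA.coeff_one, smul_eq_mul, mul_one]

section Braided

variable [BraidedCategory C] [IsCommMonObj A]

variable (a) in
lemma braiding_comp_actMul_comm (t : H ⊗[k] H) :
    (β_ A A).hom ≫ a.actMul (TensorProduct.comm k H H t) = a.actMul t := by
  induction t with
  | zero => simp
  | add s t hs ht => simp only [map_add, Preadditive.comp_add, hs, ht]
  | tmul f g => exact braiding_comp_extMul (a.act f) (a.act g)

variable (a) in
lemma actMul_comm_comul (h : H) :
    a.actMul (TensorProduct.comm k H H (comul h)) = a.actMul (comul h) := by
  rw [← cancel_epi (β_ A A).hom, braiding_comp_actMul_comm, ← mul_comp_act,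
    ← Category.assoc, IsCommMonObj.mul_comm]

lemma IsFaithful.isCocomm_of_form_injective (ha : a.IsFaithful) {e : 𝟙_ C ⟶ A ⊗ A}
    (he : Function.Injective (a.form hA e)) : Coalgebra.IsCocomm k H where
  comm_comp_comul := LinearMap.ext fun h => by
    refine eq_of_forall_lTensor_flip_eq he fun x =>
      (TensorProduct.rid k H).injective (ha.act_injective ?_)
    rw [← whiskerLeft_comp_actMul_extMul, ← whiskerLeft_comp_actMul_extMul]
    exact congrArg (fun f => (ρ_ A).inv ≫ A ◁ e ≫ (α_ A A A).inv ≫ f ⊙ a.act x)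
      (a.actMul_comm_comul h)

end Braided

end Connected

variable {a}

lemma IsUnital.isMonHom_act (ha : a.IsUnital) {g : H} (hg : IsGroupLikeElem k g) :
    IsMonHom (a.act g) where
  one_hom := by rw [ha, hg.counit_eq_one, one_smul]
  mul_hom := by rw [mul_comp_act, hg.comul_eq_tmul_self]; rfl

/-- The action of the group-like elements by algebra endomorphisms. -/
def groupLikeToEnd (ha : a.IsUnital) : GroupLike k H →* End (Mon.mk A) where
  toFun g := End.of (Mon.Hom.mk' (M := Mon.mk A) (N := Mon.mk A) (a.act g)
    (ha.isMonHom_act g.2).one_hom (ha.isMonHom_act g.2).mul_hom)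
  map_one' := Mon.Hom.ext a.act_one
  map_mul' g h := Mon.Hom.ext (a.act_mul g h)

end Bialgebra

section HopfAlgebra

variable [HopfAlgebra k H] {a : BialgebraAction k H A}

/-- The action of the group-like elements of a Hopf algebra by algebra automorphisms. -/
def groupLikeToAut (ha : a.IsUnital) : GroupLike k H →* AutAlg A :=
  (Aut.unitsEndEquivAut (Mon.mk A)).toMonoidHom.comp (MonoidHom.toHomUnits (groupLikeToEnd ha))

lemma groupLikeToAut_injective (ha : a.IsUnital) (hf : a.IsFaithful) :
    Function.Injective (groupLikeToAut ha) := fun _ _ hgh =>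
  GroupLike.val_injective (hf (congrArg (fun φ : AutAlg A => φ.hom.hom) hgh))

theorem IsFaithful.span_isGroupLikeElem_eq_top [IsAlgClosed k] [BraidedCategory C]
    (ha : a.IsFaithful) (hA : IsEtaleAlgObj k A) :
    Submodule.span k {g : H | IsGroupLikeElem k g} = ⊤ := by
  obtain ⟨σ, hσ, hl, hr⟩ := hA.separable
  have : IsCommMonObj A := ⟨hA.comm⟩
  have hB := ha.isCoseparabilityForm hA.connected hσ hl hr
  have form_injective : Function.Injective (a.form hA.connected (η[A] ≫ σ)) :=
    hB.injective fun _ _ _ => apply_mul_eq_apply_antipode_mul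
      ((ha.isUnital hA.connected).lift_form_comul_mul hA.connected _) _ _ _
  have := ha.isCocomm_of_form_injective hA.connected form_injective
  exact hB.span_isGroupLikeElem_eq_top

end HopfAlgebra

end BialgebraAction

end ExternalProduct

theorem mainTheorem1_general (k : Type w) [Field k] [IsAlgClosed k]
    {C : Type u} [Category.{v} C] [Preadditive C] [Linear k C] [MonoidalCategory C]
    [MonoidalPreadditive C] [MonoidalLinear k C] [BraidedCategory C]
    (A : C) [MonObj A] (hA : IsEtaleAlgObj k A)
    (H : Type x) [Ring H] [HopfAlgebra k H]
    (a : BialgebraAction k H A) (ha : a.IsFaithful) :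
    ∃ (G : Subgroup (AutAlg A)) (φ : MonoidAlgebra k G ≃ₐc[k] H),
      ∀ g : G, End.asHom (a.toEnd (φ (MonoidAlgebra.of k G g))) = (g : AutAlg A).hom.hom := by
  let θ := BialgebraAction.groupLikeToAut (ha.isUnital hA.connected)
  let e : GroupLike k H ≃* θ.range :=
    θ.ofInjective (BialgebraAction.groupLikeToAut_injective _ ha)
  let ψ : MonoidAlgebra k (GroupLike k H) ≃ₐc[k] H := BialgEquiv.ofBijective _
    (liftGroupLikeBialgHom_bijective (ha.span_isGroupLikeElem_eq_top hA))
  refine ⟨θ.range, (MonoidAlgebra.domCongrBialgEquiv k k e.symm).trans ψ, fun g => ?_⟩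
  obtain ⟨g, rfl⟩ := e.surjective g
  have ψ_of : ((MonoidAlgebra.domCongrBialgEquiv k k e.symm).trans ψ)
      (MonoidAlgebra.of k θ.range (e g)) = g := by
    change MonoidAlgebra.liftGroupLikeBialgHom (R := k) (A := H)
      (MonoidAlgebra.domCongr k k e.symm (MonoidAlgebra.single (e g) 1)) = g
    simp
  rw [ψ_of]
  rfl

theorem mainTheorem1 (k : Type w) [Field k] [IsAlgClosed k] [CharZero k]
    {C : Type u} [Category.{v} C] [Abelian C] [Linear k C] [MonoidalCategory C]
    [MonoidalPreadditive C] [MonoidalLinear k C] [BraidedCategory C] [Simple (𝟙_ C)]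
    (A : C) [MonObj A] (hA : IsEtaleAlgObj k A)
    (H : Type x) [Ring H] [HopfAlgebra k H]
    (a : BialgebraAction k H A) (ha : a.IsFaithful) :
    ∃ (G : Subgroup (AutAlg A)) (φ : MonoidAlgebra k G ≃ₐc[k] H),
      ∀ g : G, End.asHom (a.toEnd (φ (MonoidAlgebra.of k G g))) = (g : AutAlg A).hom.hom :=
  mainTheorem1_general k A hA H a ha
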